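/- Let $x_F = 0100101001001\ldots$ be the Fibonacci word, i.e. the infinite fixed point of the morphism $0 \mapsto 01$, $1 \mapsto 0$. Let $w$ be a non-empty factor of $x_F$ that has no overlap in $x_F$, i.e. there are no non-empty words $x, y, z$ such that $w = xy = yz$ and $xyz$ is a factor of $x_F$. Let $T(x_F)$ be the infinite word over $\{0,1,2\}$ obtained from $x_F$ by replacing, from left to right, each occurrence of $w$ by the letter $2$. Write $x_F = r_0(w)\, r_1(w)\, r_2(w) \cdots$, where $r_0(w)$ is the (possibly empty) prefix of $x_F$ that precedes the first occurrence of $w$ and, for $k \ge 1$, $r_k(w)$ is the word that extends from the beginning of the $k$-th occurrence of $w$ in $x_F$ up to the beginning of the $(k+1)$-st. Put $l_1 = |r_1(w)| - |w| + 1$ and $l_2 = |r_2(w)| - |w| + 1$, and let $\varphi = (1+\sqrt5)/2$. Then the letter $2$ occurs infinitely often in $T(x_F)$, and the increasing sequence $Y(1) < Y(2) < \cdots$ of its positions (counted from $1$) is a generalized Beatty sequence: for all $n \ge 1$, $$Y(n) = p \lfloor n\varphi \rfloor + q n + r, \qquad p = l_1 - l_2, \quad q = 2 l_2 - l_1, \quad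 r = |r_0(w)| - l_2 + 1.$$ -/

import Mathlib

namespace FibKimberling

/-- The Fibonacci morphism `0 ↦ 01, 1 ↦ 0` on letters. -/
def fibLetter (a : Fin 2) : List (Fin 2) := if a = 0 then [0, 1] else [0]

/-- The Fibonacci morphism on finite words. -/
def fibMorphism (w : List (Fin 2)) : List (Fin 2) := w.flatMap fibLetter

/-- The iterates of the Fibonacci morphism on the letter `0`: `0, 01, 010, 01001, …`. -/
def fibIter (n : ℕ) : List (Fin 2) := fibMorphism^[n] [0]

theorem fibIter_succ (n : ℕ) : fibIter (n + 1) = fibMorphism (fibIter n) :=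
  Function.iterate_succ_apply' _ _ _

theorem length_le_fibMorphism (w : List (Fin 2)) : w.length ≤ (fibMorphism w).length := by
  induction w with
  | nil => simp
  | cons a t ih =>
    have h : 1 ≤ (fibLetter a).length := by unfold fibLetter; split <;> simp
    simp only [fibMorphism, List.flatMap_cons, List.length_append, List.length_cons] at ih ⊢
    omega

theorem exists_fibIter_eq_cons (n : ℕ) : ∃ t, fibIter n = 0 :: t := by
  induction n with
  | zero => exact ⟨[], rfl⟩
  | succ n ih =>
    obtain ⟨t, ht⟩ := ih
    exact ⟨1 :: fibMorphism t, by rw [fibIter_succ, ht]; rfl⟩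

theorem lt_length_fibIter (n : ℕ) : n < (fibIter n).length := by
  induction n with
  | zero => simp [fibIter]
  | succ n ih =>
    obtain ⟨t, ht⟩ := exists_fibIter_eq_cons n
    have h := length_le_fibMorphism t
    have e : fibIter (n + 1) = 0 :: 1 :: fibMorphism t := by rw [fibIter_succ, ht]; rfl
    rw [e]
    rw [ht] at ih
    simp only [List.length_cons] at ih ⊢
    omega

/-- The Fibonacci word `0100101001001…`, the fixed point of the Fibonacci morphism; its letters
are numbered from `0`. Each iterate `fibIter n` is a prefix of the next one. -/
def fibWord (n : ℕ) : Fin 2 := (fibIter n)[n]'(lt_length_fibIter n)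

/-- The word `x i, x (i+1), …, x (i+n-1)`. -/
def slice {A : Type*} (x : ℕ → A) (i n : ℕ) : List A := (List.range n).map fun k => x (i + k)

/-- The finite word `w` occurs in `x`, starting at the index `i`. -/
def OccursAt {A : Type*} (x : ℕ → A) (w : List A) (i : ℕ) : Prop := slice x i w.length = w

instance {A : Type*} [DecidableEq A] (x : ℕ → A) (w : List A) (i : ℕ) :
    Decidable (OccursAt x w i) := inferInstanceAs (Decidable (slice x i w.length = w))

/-- `w` is a factor of the infinite word `x`. -/
def IsFactor {A : Type*} (x : ℕ → A) (w : List A) : Prop := ∃ i, OccursAt x w i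

/-- `w` has an overlap in `x`: `w = ab = bc` with `a, b, c` non-empty and `abc` a factor of `x`. -/
def HasOverlap {A : Type*} (x : ℕ → A) (w : List A) : Prop :=
  ∃ a b c : List A, a ≠ [] ∧ b ≠ [] ∧ c ≠ [] ∧ w = a ++ b ∧ w = b ++ c ∧ IsFactor x (a ++ b ++ c)

/-- The index at which the left-to-right replacement procedure stands in the Fibonacci word
after it has written `k` letters: an occurrence of `w` is consumed as a whole,
otherwise a single letter is consumed. -/
def readIndex (w : List (Fin 2)) : ℕ → ℕ
  | 0 => 0
  | k + 1 =>
    if OccursAt fibWord w (readIndex w k) then readIndex w k + w.length else readIndex w k + 1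

/-- The transform `[w ↦ 2]` of the Fibonacci word: the occurrences of `w` are replaced,
from left to right, by the letter `2`, and the other letters are kept. -/
def transform (w : List (Fin 2)) (k : ℕ) : Fin 3 :=
  if OccursAt fibWord w (readIndex w k) then 2 else (fibWord (readIndex w k)).castSucc

/-- `m` is a position of the letter `a` in `x`, where positions are counted from `1`. -/
def IsPosition {A : Type*} (x : ℕ → A) (a : A) (m : ℕ) : Prop := 1 ≤ m ∧ x (m - 1) = a

/-- The increasing sequence `Y(1) < Y(2) < …` of the positions of the letter `a` in `x`
(meaningful for `n ≥ 1`, when there are at least `n` such positions). -/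
noncomputable def positionSeq {A : Type*} (x : ℕ → A) (a : A) (n : ℕ) : ℕ :=
  Nat.nth (IsPosition x a) (n - 1)

/-- The index of the `k`-th occurrence of `w` in `x`, with `k = 0` for the first occurrence. -/
noncomputable def occurrence {A : Type*} (x : ℕ → A) (w : List A) (k : ℕ) : ℕ :=
  Nat.nth (OccursAt x w) k

/-- The words of the decomposition `x = r₀(w) r₁(w) r₂(w) …`: the word `r₀(w)` precedes the first
occurrence of `w`, and `r_k(w)`, `k ≥ 1`, reaches from the `k`-th occurrence of `w` up to
the next one. -/
noncomputable def returnWord {A : Type*} (x : ℕ → A) (w : List A) : ℕ → List A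
  | 0 => slice x 0 (occurrence x w 0)
  | k + 1 => slice x (occurrence x w k) (occurrence x w (k + 1) - occurrence x w k)

/-- The generalized Beatty sequence `V(n) = p ⌊n α⌋ + q n + r`. -/
noncomputable def generalizedBeatty (α : ℝ) (p q r : ℤ) (n : ℕ) : ℤ :=
  p * ⌊(n : ℝ) * α⌋ + q * n + r

end FibKimberling

namespace FibKimberling

/-! ### Self-similarity of the Fibonacci word -/

/-! The Fibonacci word is its own image under the morphism σ, and so it is cut into blocks `01` and
`0`, each beginning with its only zero. Write Z(n) for `zeroCount n`; block n starts at n + Z(n).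
Zeros reveal the cuts, so the occurrences of a non-empty factor are the images, under j ↦ j + Z(j) +
δ, of the occurrences of another factor that ends earlier (`exists_desubstitution`). Descending to
the empty word, which occurs at every t, one finds that the occurrences of any factor are a Z(t) + b
t + c for t = 0, 1, 2, … (`exists_occurrences_affine`).

The same self-similarity gives ⌊(t+1)φ⌋ = Z(t) + t + 1 (`floor_mul_goldenRatio`), so these are
generalized Beatty sequences. Without overlaps the replacement meets every occurrence of w, and each
earlier replacement moves the later ones left by |w| - 1 (`transform_positions`); the form of the
sequence is preserved. As Z takes the values 0, 1, 1 at 0, 1, 2, the first two return words have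
lengths a + b and b, which identifies the coefficients. -/

theorem fibMorphism_append (u v : List (Fin 2)) :
    fibMorphism (u ++ v) = fibMorphism u ++ fibMorphism v := by
  simp [fibMorphism]

theorem fibMorphism_prefix {u v : List (Fin 2)} (h : u <+: v) :
    fibMorphism u <+: fibMorphism v := by
  obtain ⟨t, rfl⟩ := h
  rw [fibMorphism_append]
  exact List.prefix_append _ _

theorem fibIter_prefix_succ (n : ℕ) : fibIter n <+: fibIter (n + 1) := by
  induction n with
  | zero => exact ⟨[1], rfl⟩
  | succ n ih =>
    rw [fibIter_succ n, fibIter_succ (n + 1)]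
    exact fibMorphism_prefix ih

theorem fibIter_prefix_of_le {m n : ℕ} (h : m ≤ n) : fibIter m <+: fibIter n := by
  induction h with
  | refl => exact List.prefix_rfl
  | step _ ih => exact ih.trans (fibIter_prefix_succ _)

theorem getElem?_eq_of_prefix {A : Type*} {u v : List A} (h : u <+: v) {i : ℕ}
    (hi : i < u.length) : v[i]? = u[i]? := by
  obtain ⟨t, rfl⟩ := h
  exact List.getElem?_append_left hi

theorem fibIter_getElem? {n i : ℕ} (h : i < (fibIter n).length) :
    (fibIter n)[i]? = some (fibWord i) := by
  have e : (fibIter i)[i]? = some (fibWord i) := by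
    rw [List.getElem?_eq_getElem (lt_length_fibIter i)]; rfl
  rcases le_total i n with hin | hin
  · rw [getElem?_eq_of_prefix (fibIter_prefix_of_le hin) (lt_length_fibIter i), e]
  · rw [← getElem?_eq_of_prefix (fibIter_prefix_of_le hin) h, e]

theorem length_slice {A : Type*} (x : ℕ → A) (i n : ℕ) : (slice x i n).length = n := by
  simp [slice]

theorem slice_getElem? {A : Type*} (x : ℕ → A) {i n k : ℕ} (h : k < n) :
    (slice x i n)[k]? = some (x (i + k)) := by
  simp [slice, h]

theorem slice_succ {A : Type*} (x : ℕ → A) (i n : ℕ) :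
    slice x i (n + 1) = slice x i n ++ [x (i + n)] := by
  simp [slice, List.range_succ]

theorem slice_eq_slice_iff {A : Type*} (x : ℕ → A) (i j n : ℕ) :
    slice x i n = slice x j n ↔ ∀ t < n, x (i + t) = x (j + t) := by
  simp [slice]

theorem eq_slice_of_prefix_fibIter {u : List (Fin 2)} {n : ℕ} (h : u <+: fibIter n) :
    u = slice fibWord 0 u.length := by
  apply List.ext_getElem?
  intro i
  rcases lt_or_ge i u.length with hi | hi
  · rw [slice_getElem? _ hi, ← getElem?_eq_of_prefix h hi,
      fibIter_getElem? (hi.trans_le h.length_le), zero_add]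
  · rw [List.getElem?_eq_none hi, List.getElem?_eq_none (by rwa [length_slice])]

theorem slice_prefix_fibIter (n : ℕ) : slice fibWord 0 n <+: fibIter n := by
  have h : (fibIter n).take n <+: fibIter n := List.take_prefix _ _
  have e := eq_slice_of_prefix_fibIter h
  rw [List.length_take, min_eq_left (lt_length_fibIter n).le] at e
  rwa [← e]

/-- The number of zeros among the first `n` letters of the Fibonacci word. -/
def zeroCount (n : ℕ) : ℕ := Nat.count (fun i => fibWord i = 0) n

/-- The index at which the image of the `n`-th letter starts when the Fibonacci word is read as
its own image under the Fibonacci morphism. -/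
def blockStart (n : ℕ) : ℕ := n + zeroCount n

theorem fibWord_ne_zero {n : ℕ} : fibWord n ≠ 0 ↔ fibWord n = 1 := by
  generalize fibWord n = a
  revert a
  decide

@[simp] theorem zeroCount_zero : zeroCount 0 = 0 := rfl

theorem zeroCount_succ (n : ℕ) :
    zeroCount (n + 1) = zeroCount n + if fibWord n = 0 then 1 else 0 :=
  Nat.count_succ _ _

theorem zeroCount_mono : Monotone zeroCount := Nat.count_monotone _

theorem blockStart_succ (n : ℕ) :
    blockStart (n + 1) = blockStart n + if fibWord n = 0 then 2 else 1 := by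
  unfold blockStart
  rw [zeroCount_succ]
  split <;> omega

theorem blockStart_strictMono : StrictMono blockStart :=
  strictMono_nat_of_lt_succ fun n => by rw [blockStart_succ]; split <;> omega

theorem length_fibMorphism_slice (n : ℕ) :
    (fibMorphism (slice fibWord 0 n)).length = blockStart n := by
  induction n with
  | zero => rfl
  | succ n ih =>
    rw [slice_succ, fibMorphism_append, List.length_append, ih, blockStart_succ, zero_add]
    simp only [fibMorphism, List.flatMap_singleton, fibLetter]
    split <;> rfl

theorem fibMorphism_slice (n : ℕ) :
    fibMorphism (slice fibWord 0 n) = slice fibWord 0 (blockStart n) := by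
  have h := fibMorphism_prefix (slice_prefix_fibIter n)
  rw [← fibIter_succ] at h
  rw [← length_fibMorphism_slice]
  exact eq_slice_of_prefix_fibIter h

/-- The fixed-point property read block by block: compare the images of the prefixes of lengths n
and n + 1. -/
theorem fibWord_blockStart_add {n t : ℕ} (ht : t < (fibLetter (fibWord n)).length) :
    (fibLetter (fibWord n))[t]? = some (fibWord (blockStart n + t)) := by
  have h := fibMorphism_slice (n + 1)
  have hl := length_fibMorphism_slice (n + 1)
  rw [slice_succ, fibMorphism_append, fibMorphism_slice, zero_add] at h hl
  have e : fibMorphism [fibWord n] = fibLetter (fibWord n) := by simp [fibMorphism]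
  rw [e] at h hl
  rw [List.length_append, length_slice] at hl
  have h2 := congrArg (fun l => l[blockStart n + t]?) h
  rw [slice_getElem? _ (by omega), zero_add,
    List.getElem?_append_right (by rw [length_slice]; omega), length_slice,
    Nat.add_sub_cancel_left] at h2
  exact h2

theorem fibWord_blockStart (n : ℕ) : fibWord (blockStart n) = 0 := by
  have h := fibWord_blockStart_add (n := n) (t := 0) (by unfold fibLetter; split <;> simp)
  have e : (fibLetter (fibWord n))[0]? = some 0 := by unfold fibLetter; split <;> rfl
  rw [e] at h
  simpa using h.symm

theorem fibWord_blockStart_succ_of_zero {n : ℕ} (hn : fibWord n = 0) :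
    fibWord (blockStart n + 1) = 1 := by
  have h := fibWord_blockStart_add (n := n) (t := 1) (by simp [fibLetter, hn])
  rw [hn] at h
  simpa [fibLetter] using h.symm

theorem fibWord_blockStart_succ_eq_one_iff (n : ℕ) :
    fibWord (blockStart n + 1) = 1 ↔ fibWord n = 0 := by
  refine ⟨fun h => ?_, fibWord_blockStart_succ_of_zero⟩
  by_contra hn
  have e := blockStart_succ n
  rw [if_neg hn] at e
  rw [← e, fibWord_blockStart] at h
  exact absurd h (by decide)

theorem exists_blockStart (p : ℕ) :
    ∃ k, p = blockStart k ∨ fibWord k = 0 ∧ p = blockStart k + 1 := by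
  induction p with
  | zero => exact ⟨0, Or.inl rfl⟩
  | succ p ih =>
    obtain ⟨k, rfl | ⟨hk, rfl⟩⟩ := ih
    · by_cases hk : fibWord k = 0
      · exact ⟨k, Or.inr ⟨hk, rfl⟩⟩
      · exact ⟨k + 1, Or.inl (by rw [blockStart_succ, if_neg hk])⟩
    · exact ⟨k + 1, Or.inl (by rw [blockStart_succ, if_pos hk])⟩

theorem exists_blockStart_eq {p : ℕ} (hp : fibWord p = 0) : ∃ k, p = blockStart k := by
  obtain ⟨k, rfl | ⟨hk, rfl⟩⟩ := exists_blockStart p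
  · exact ⟨k, rfl⟩
  · rw [fibWord_blockStart_succ_of_zero hk] at hp
    exact absurd hp (by decide)

theorem exists_blockStart_succ_eq {p : ℕ} (hp : fibWord p = 1) :
    ∃ k, p = blockStart k + 1 ∧ p + 1 = blockStart (k + 1) := by
  obtain ⟨k, rfl | ⟨hk, rfl⟩⟩ := exists_blockStart p
  · rw [fibWord_blockStart] at hp
    exact absurd hp (by decide)
  · exact ⟨k, rfl, by rw [blockStart_succ, if_pos hk]⟩

theorem fibWord_succ_eq_zero {p : ℕ} (hp : fibWord p = 1) : fibWord (p + 1) = 0 := by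
  obtain ⟨k, -, hk⟩ := exists_blockStart_succ_eq hp
  rw [hk, fibWord_blockStart]

/-- Each block contains exactly one zero, so `blockStart` enumerates the zeros. -/
theorem zeroCount_blockStart (n : ℕ) : zeroCount (blockStart n) = n := by
  induction n with
  | zero => rfl
  | succ n ih =>
    rw [blockStart_succ]
    split_ifs with h
    · rw [zeroCount_succ, zeroCount_succ, fibWord_blockStart, ih,
        fibWord_blockStart_succ_of_zero h]
      simp
    · rw [zeroCount_succ, fibWord_blockStart, ih]
      simp

theorem zeroCount_blockStart_succ (n : ℕ) : zeroCount (blockStart n + 1) = n + 1 := by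
  rw [zeroCount_succ, fibWord_blockStart, zeroCount_blockStart]
  simp

/-! ### Desubstitution of factors -/

/-- Both differences are the length of the image of the common word; the sums avoid truncated
subtraction. -/
theorem blockStart_add_of_agree {j k m : ℕ} (h : ∀ t < m, fibWord (j + t) = fibWord (k + t)) :
    blockStart (j + m) + blockStart k = blockStart (k + m) + blockStart j := by
  induction m with
  | zero => simp [add_comm]
  | succ m ih =>
    have := ih fun t ht => h t (ht.trans (Nat.lt_succ_self m))
    rw [← add_assoc, ← add_assoc, blockStart_succ, blockStart_succ, h m (Nat.lt_succ_self m)]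
    omega

/-- The right endpoint is included because the next block also starts with 0: agreement on u passes
to σ(u)0, not merely to σ(u). -/
theorem agree_blockStart {j k m : ℕ} (h : ∀ t < m, fibWord (j + t) = fibWord (k + t)) (t : ℕ)
    (ht : blockStart k + t ≤ blockStart (k + m)) :
    fibWord (blockStart j + t) = fibWord (blockStart k + t) := by
  induction m with
  | zero =>
    obtain rfl : t = 0 := by simpa using ht
    simp [fibWord_blockStart]
  | succ m ih =>
    have h' : ∀ t < m, fibWord (j + t) = fibWord (k + t) :=
      fun t ht => h t (ht.trans (Nat.lt_succ_self m))
    rcases le_or_gt (blockStart k + t) (blockStart (k + m)) with hle | hlt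
    · exact ih h' hle
    · have e := blockStart_add_of_agree h'
      have e' := blockStart_add_of_agree h
      rcases ht.eq_or_lt with heq | hlt'
      · rw [heq, show blockStart j + t = blockStart (j + (m + 1)) by omega,
          fibWord_blockStart, fibWord_blockStart]
      · have hs := blockStart_succ (k + m)
        rw [add_assoc] at hs
        by_cases hk : fibWord (k + m) = 0
        · rw [if_pos hk] at hs
          rw [show blockStart k + t = blockStart (k + m) + 1 by omega,
            show blockStart j + t = blockStart (j + m) + 1 by omega,
            fibWord_blockStart_succ_of_zero hk,
            fibWord_blockStart_succ_of_zero ((h m (Nat.lt_succ_self m)).trans hk)]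
        · rw [if_neg hk] at hs
          omega

/-- A letter is recovered from the second letter after its block starts, which is 1 exactly for the
block `01`. For a final block `0` that letter is the extra zero in σ(u)0. -/
theorem agree_of_agree_blockStart {j k m : ℕ}
    (h : ∀ t, blockStart k + t ≤ blockStart (k + m) →
      fibWord (blockStart j + t) = fibWord (blockStart k + t)) :
    ∀ t < m, fibWord (j + t) = fibWord (k + t) := by
  induction m with
  | zero => simp
  | succ m ih =>
    have hlt : blockStart (k + m) < blockStart (k + (m + 1)) := blockStart_strictMono (by omega)
    have h' := ih fun t ht => h t (by omega)
    intro t ht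
    rcases Nat.lt_succ_iff_lt_or_eq.1 ht with ht | rfl
    · exact h' t ht
    · have e := blockStart_add_of_agree h'
      have hle : blockStart k ≤ blockStart (k + t) :=
        blockStart_strictMono.monotone (by omega)
      have hx := h (blockStart (k + t) - blockStart k + 1) (by omega)
      rw [show blockStart j + (blockStart (k + t) - blockStart k + 1)
          = blockStart (j + t) + 1 by omega,
        show blockStart k + (blockStart (k + t) - blockStart k + 1)
          = blockStart (k + t) + 1 by omega] at hx
      have hiff : fibWord (j + t) = 0 ↔ fibWord (k + t) = 0 := by
        rw [← fibWord_blockStart_succ_eq_one_iff, hx, fibWord_blockStart_succ_eq_one_iff]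
      by_cases hk : fibWord (k + t) = 0
      · rw [hk, hiff.2 hk]
      · rw [fibWord_ne_zero.1 hk, fibWord_ne_zero.1 (mt hiff.1 hk)]

/-- Every non-empty factor arises from an image `σ(u)0`, possibly by removing the first or the last
letter, and its occurrences correspond to those of `u`. -/
theorem exists_desubstitution (i n : ℕ) (hn : 1 ≤ n) :
    ∃ k m δ, δ ≤ 1 ∧ k + m < i + n ∧
      ∀ p, (∀ t < n, fibWord (p + t) = fibWord (i + t)) ↔
        ∃ j, (∀ t < m, fibWord (j + t) = fibWord (k + t)) ∧ p = blockStart j + δ := by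
  -- A leading 1 is the second letter of a block `01`; then δ = 1 records the missing zero.
  obtain ⟨k, δ, hδ, hi, hleft⟩ : ∃ k δ, δ ≤ 1 ∧ i = blockStart k + δ ∧
      ∀ p, fibWord p = fibWord i → ∃ j, p = blockStart j + δ := by
    by_cases h0 : fibWord i = 0
    · obtain ⟨k, hk⟩ := exists_blockStart_eq h0
      exact ⟨k, 0, by omega, hk, fun p hp => exists_blockStart_eq (hp.trans h0)⟩
    · have h1 := fibWord_ne_zero.1 h0
      obtain ⟨k, hk, -⟩ := exists_blockStart_succ_eq h1
      exact ⟨k, 1, le_rfl, hk, fun p hp =>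
        (exists_blockStart_succ_eq (hp.trans h1)).imp fun _ h => h.1⟩
  -- A final 0 is itself the closing zero of σ(u)0. A final 1 is always followed by 0, so the
  -- closing zero lies just outside the factor.
  obtain ⟨K, hK, hK', hright⟩ : ∃ K, i + n - 1 ≤ blockStart K ∧ blockStart K ≤ i + n ∧
      ∀ p, fibWord (p + (n - 1)) = fibWord (i + (n - 1)) → blockStart K = i + n →
        fibWord (p + n) = 0 := by
    by_cases h0 : fibWord (i + (n - 1)) = 0
    · obtain ⟨K, hK⟩ := exists_blockStart_eq h0
      exact ⟨K, by omega, by omega, fun p _ h => by omega⟩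
    · have h1 := fibWord_ne_zero.1 h0
      obtain ⟨K, -, hK⟩ := exists_blockStart_succ_eq h1
      refine ⟨K + 1, by omega, by omega, fun p hp _ => ?_⟩
      have := fibWord_succ_eq_zero (hp.trans h1)
      rwa [add_assoc, Nat.sub_add_cancel hn] at this
  have hkK : k ≤ K := blockStart_strictMono.le_iff_le.1 (by omega)
  -- The descent is on the end of the occurrence: the length need not drop, as the factor `1`
  -- desubstitutes to `0`.
  have hKlt : K < i + n := by
    rcases Nat.eq_zero_or_pos K with rfl | hpos
    · omega
    · have : zeroCount 1 ≤ zeroCount K := zeroCount_mono hpos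
      have h1 : zeroCount 1 = 1 := zeroCount_blockStart_succ 0
      have : blockStart K = K + zeroCount K := rfl
      omega
  obtain ⟨m, rfl⟩ := Nat.exists_eq_add_of_le hkK
  refine ⟨k, m, δ, hδ, hKlt, fun p => ⟨fun h => ?_, ?_⟩⟩
  · obtain ⟨j, rfl⟩ := hleft p (by simpa using h 0 (by omega))
    refine ⟨j, agree_of_agree_blockStart fun t ht => ?_, rfl⟩
    rcases lt_or_ge t δ with htδ | htδ
    · obtain rfl : t = 0 := by omega
      simp [fibWord_blockStart]
    · obtain ⟨r, rfl⟩ := Nat.exists_eq_add_of_le htδ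
      rw [← add_assoc, ← add_assoc, ← hi]
      rcases lt_or_ge r n with hr | hr
      · exact h r hr
      · obtain rfl : r = n := by omega
        have hend : blockStart (k + m) = i + r := by omega
        rw [hright _ (h (r - 1) (by omega)) hend, ← hend, fibWord_blockStart]
  · rintro ⟨j, hj, rfl⟩ t ht
    rw [hi, add_assoc, add_assoc]
    exact agree_blockStart hj _ (by omega)

/-- The occurrences of a factor of the Fibonacci word, and the numbers of zeros that precede them,
are affine functions of the number of the occurrence and of `zeroCount`. -/
theorem exists_occurrences_affine (i n : ℕ) :
    ∃ a b c a' b' c' : ℕ, 1 ≤ b ∧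
      (∀ p, (∀ t < n, fibWord (p + t) = fibWord (i + t)) ↔
        ∃ t, a * zeroCount t + b * t + c = p) ∧
      ∀ t, zeroCount (a * zeroCount t + b * t + c) = a' * zeroCount t + b' * t + c' := by
  induction hN : i + n using Nat.strong_induction_on generalizing i n with
  | _ N ih =>
    rcases Nat.eq_zero_or_pos n with rfl | hn
    -- The empty word occurs at every t, preceded by Z(t) zeros.
    · exact ⟨0, 1, 0, 1, 0, 0, le_rfl, by simp, by simp⟩
    · obtain ⟨k, m, δ, hδ, hlt, hocc⟩ := exists_desubstitution i n hn
      obtain ⟨a, b, c, a', b', c', hb, hf, hz⟩ := ih (k + m) (by omega) k m rfl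
      -- Since `blockStart p` is p + Z(p), the affine form survives only if Z along the occurrences
      -- is affine too; hence the second half of the induction hypothesis.
      have hs : ∀ t, (a + a') * zeroCount t + (b + b') * t + (c + c' + δ) =
          blockStart (a * zeroCount t + b * t + c) + δ := fun t => by
        rw [blockStart, hz]; ring
      refine ⟨a + a', b + b', c + c' + δ, a, b, c + δ, by omega, fun p => ?_, fun t => ?_⟩
      · simp only [hocc, hf, hs]
        constructor
        · rintro ⟨_, ⟨t, rfl⟩, rfl⟩
          exact ⟨t, rfl⟩
        · rintro ⟨t, rfl⟩
          exact ⟨_, ⟨t, rfl⟩, rfl⟩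
      · rw [hs]
        obtain rfl | rfl : δ = 0 ∨ δ = 1 := by omega
        · rw [add_zero, zeroCount_blockStart, add_zero]
        · rw [zeroCount_blockStart_succ, add_assoc]

/-! ### The number of zeros in a prefix -/

/-- If Z(t) = r + 1, then t lies between consecutive zeros: r + Z(r) < t ≤ r + 1 + Z(r + 1). The
bounds at r and r + 1 give (r+1)φ < t + 1 < (r+2)φ, and multiplying by φ - 1 = 1/φ gives those at t.
-/
theorem zeroCount_bounds (t : ℕ) :
    (zeroCount t + t + 1 : ℝ) < (t + 1) * Real.goldenRatio ∧
      (t + 1) * Real.goldenRatio < zeroCount t + t + 2 := by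
  have hg1 := Real.one_lt_goldenRatio
  have hg2 := Real.goldenRatio_lt_two
  have hsq := Real.goldenRatio_sq
  have h1 : zeroCount 1 = 1 := zeroCount_blockStart_succ 0
  induction t using Nat.strong_induction_on with
  | _ t ih =>
    -- For t = 1 the index r + 1 equals t, so the induction can only start at 2.
    rcases Nat.lt_or_ge t 2 with ht | ht
    · obtain rfl | rfl : t = 0 ∨ t = 1 := by omega
      · constructor <;> simp <;> linarith
      · rw [h1]
        constructor <;> push_cast <;> nlinarith
    · obtain ⟨r, hr⟩ : ∃ r, zeroCount t = r + 1 :=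
        Nat.exists_eq_succ_of_ne_zero (by have := zeroCount_mono (by omega : 1 ≤ t); omega)
      have hlow : blockStart r < t := by
        by_contra! h
        have := zeroCount_mono h
        rw [zeroCount_blockStart] at this
        omega
      have hup : t ≤ blockStart (r + 1) := by
        by_contra! h
        have := zeroCount_mono (Nat.succ_le_of_lt h)
        rw [zeroCount_blockStart_succ] at this
        omega
      have hrt : r + 1 < t := by
        have h2 : zeroCount 2 = 1 := by
          have := zeroCount_blockStart 1
          rwa [blockStart, h1] at this
        rcases Nat.eq_zero_or_pos r with rfl | hpos
        · omega
        · have : zeroCount 1 ≤ zeroCount r := zeroCount_mono hpos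
          unfold blockStart at hlow
          omega
      have i1 := (ih r (by omega)).2
      have i2 := (ih (r + 1) hrt).1
      unfold blockStart at hlow hup
      have hlow' : (r + zeroCount r + 1 : ℝ) ≤ t := by exact_mod_cast hlow
      have hup' : (t : ℝ) ≤ r + 1 + zeroCount (r + 1) := by exact_mod_cast hup
      rw [hr]
      push_cast at i2 ⊢
      constructor
      · have : ((r : ℝ) + 1) * Real.goldenRatio < t + 1 := by linarith
        nlinarith
      · have : (t + 1 : ℝ) < (r + 1 + 1) * Real.goldenRatio := by linarith
        nlinarith

theorem floor_mul_goldenRatio (t : ℕ) :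
    ⌊((t + 1 : ℕ) : ℝ) * Real.goldenRatio⌋ = (zeroCount t + t + 1 : ℤ) := by
  obtain ⟨h1, h2⟩ := zeroCount_bounds t
  rw [Int.floor_eq_iff]
  push_cast
  constructor <;> linarith

/-! ### The transform -/

/-- A strictly increasing sequence is determined by its range. -/
theorem nth_eq_of_strictMono {p : ℕ → Prop} {f : ℕ → ℕ} (hf : StrictMono f)
    (hp : ∀ m, p m ↔ ∃ t, f t = m) (n : ℕ) : Nat.nth p n = f n := by
  have hinf : (Set.ofPred p).Infinite := by
    have e : Set.ofPred p = Set.range f := Set.ext hp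
    rw [e]
    exact Set.infinite_range_of_injective hf.injective
  refine congrFun ((Nat.nth_strictMono hinf).range_inj hf |>.1 ?_) n
  rw [Nat.range_nth_of_infinite hinf]
  exact Set.ext hp

theorem occursAt_slice_iff {A : Type*} (x : ℕ → A) (i n j : ℕ) :
    OccursAt x (slice x i n) j ↔ ∀ t < n, x (j + t) = x (i + t) := by
  rw [OccursAt, length_slice, slice_eq_slice_iff]

/-- Two occurrences at a distance less than |w| share a non-empty word y; the stretch from the start
of the first to the end of the second is then xyz with w = xy = yz. -/
theorem length_le_of_not_hasOverlap {A : Type*} {x : ℕ → A} {w : List A} (h : ¬ HasOverlap x w)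
    {i j : ℕ} (hij : i < j) (hi : OccursAt x w i) (hj : OccursAt x w j) :
    i + w.length ≤ j := by
  by_contra! hlt
  obtain ⟨d, rfl⟩ := Nat.exists_eq_add_of_lt hij
  have slice_add : ∀ i m n, slice x i (m + n) = slice x i m ++ slice x (i + m) n := by
    intro i m n
    simp [slice, List.range_add, Function.comp_def, add_assoc]
  have ne : ∀ i n, 0 < n → slice x i n ≠ [] := fun i n hn h0 => by
    have := congrArg List.length h0
    rw [length_slice, List.length_nil] at this
    omega
  unfold OccursAt at hi hj
  obtain ⟨e, he⟩ : ∃ e, w.length = d + 1 + e := Nat.exists_eq_add_of_le (by omega)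
  refine h ⟨slice x i (d + 1), slice x (i + (d + 1)) e, slice x (i + (d + 1) + e) (d + 1),
    ne _ _ (by omega), ne _ _ (by omega), ne _ _ (by omega), ?_, ?_, i, ?_⟩
  · rw [← slice_add, ← he, hi]
  · rw [← slice_add, add_comm e, ← he, ← add_assoc, hj]
  · rw [OccursAt, ← slice_add, add_assoc i, ← slice_add, length_slice]

/-- Each replacement consumes |w| letters instead of one. -/
theorem readIndex_eq (w : List (Fin 2)) (hne : w ≠ []) (k : ℕ) :
    readIndex w k =
      k + (w.length - 1) * Nat.count (fun m => OccursAt fibWord w (readIndex w m)) k := by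
  have hpos := List.length_pos_of_ne_nil hne
  induction k with
  | zero => simp [readIndex]
  | succ k ih =>
    rw [readIndex, Nat.count_succ]
    split_ifs with h
    · rw [mul_add]; omega
    · rw [add_zero]; omega

theorem readIndex_strictMono {w : List (Fin 2)} (hne : w ≠ []) : StrictMono (readIndex w) := by
  have hpos := List.length_pos_of_ne_nil hne
  refine strictMono_nat_of_lt_succ fun k => ?_
  rw [readIndex]
  split <;> omega

/-- The procedure could skip an occurrence only by consuming an earlier one that overlaps it. The
argument looks at the last reading index not beyond p. -/
theorem exists_readIndex_eq {w : List (Fin 2)} (hne : w ≠ []) (hov : ¬ HasOverlap fibWord w)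
    {p : ℕ} (hp : OccursAt fibWord w p) : ∃ k, readIndex w k = p := by
  have hex : ∃ k, p < readIndex w k :=
    ⟨p + 1, (Nat.lt_succ_self p).trans_le ((readIndex_strictMono hne).le_apply)⟩
  classical
  obtain ⟨k, hk⟩ : ∃ k, Nat.find hex = k + 1 := by
    refine Nat.exists_eq_succ_of_ne_zero fun h0 => ?_
    have := Nat.find_spec hex
    rw [h0, readIndex] at this
    omega
  have hlt : p < readIndex w (k + 1) := hk ▸ Nat.find_spec hex
  have hle : readIndex w k ≤ p := not_lt.1 (Nat.find_min hex (by omega))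
  refine ⟨k, hle.eq_or_lt.resolve_right fun hlt' => ?_⟩
  rw [readIndex] at hlt
  split_ifs at hlt with h
  · have := length_le_of_not_hasOverlap hov hlt' h hp
    omega
  · omega

theorem transform_eq_two_iff (w : List (Fin 2)) (k : ℕ) :
    transform w k = 2 ↔ OccursAt fibWord w (readIndex w k) := by
  unfold transform
  split_ifs with h
  · simp [h]
  · simp only [h, iff_false]
    generalize fibWord _ = a
    revert a
    decide

/-- The `n`-th letter `2` of the transform comes from the `n`-th occurrence of `w`. -/
theorem transform_positions {w : List (Fin 2)} (hne : w ≠ []) (hov : ¬ HasOverlap fibWord w)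
    (hinf : (Set.ofPred (OccursAt fibWord w)).Infinite) :
    {m | IsPosition (transform w) 2 m}.Infinite ∧
      ∀ n, positionSeq (transform w) 2 (n + 1) + (w.length - 1) * n =
        occurrence fibWord w n + 1 := by
  classical
  set P : ℕ → Prop := fun m => OccursAt fibWord w (readIndex w m)
  have hmono := readIndex_strictMono hne
  have hPinf : (Set.ofPred P).Infinite := by
    intro hfin
    refine hinf ((hfin.image (readIndex w)).subset fun p hp => ?_)
    obtain ⟨k, rfl⟩ := exists_readIndex_eq hne hov hp
    exact ⟨k, hp, rfl⟩
  have hPmono := Nat.nth_strictMono hPinf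
  have hocc : ∀ n, occurrence fibWord w n = readIndex w (Nat.nth P n) := by
    refine nth_eq_of_strictMono (hmono.comp hPmono) fun p => ⟨fun hp => ?_, ?_⟩
    · obtain ⟨k, rfl⟩ := exists_readIndex_eq hne hov hp
      exact ⟨Nat.count P k, congrArg (readIndex w) (Nat.nth_count hp)⟩
    · rintro ⟨t, rfl⟩
      exact Nat.nth_mem_of_infinite hPinf t
  have hposmono : StrictMono fun t => Nat.nth P t + 1 :=
    fun a b hab => Nat.succ_lt_succ (hPmono hab)
  have hpos : ∀ m, IsPosition (transform w) 2 m ↔ ∃ t, Nat.nth P t + 1 = m := by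
    intro m
    rw [IsPosition, transform_eq_two_iff]
    constructor
    · rintro ⟨h1, h2⟩
      have e : Nat.nth P (Nat.count P (m - 1)) = m - 1 := Nat.nth_count h2
      exact ⟨Nat.count P (m - 1), by omega⟩
    · rintro ⟨t, rfl⟩
      exact ⟨by omega, Nat.nth_mem_of_infinite hPinf t⟩
  refine ⟨?_, fun n => ?_⟩
  · have e : {m | IsPosition (transform w) 2 m} = Set.range fun t => Nat.nth P t + 1 :=
      Set.ext hpos
    rw [e]
    exact Set.infinite_range_of_injective hposmono.injective
  · have e : positionSeq (transform w) 2 (n + 1) = Nat.nth P n + 1 :=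
      nth_eq_of_strictMono hposmono hpos n
    have hc : Nat.count P (Nat.nth P n) = n := Nat.count_nth_of_infinite hPinf n
    have hr := readIndex_eq w hne (Nat.nth P n)
    rw [e, hocc, hr]
    rw [show Nat.count (fun m => OccursAt fibWord w (readIndex w m)) (Nat.nth P n) = n by
      convert hc]
    ring

end FibKimberling

/-! ### Coefficients from the return words -/

open FibKimberling

theorem mainTheorem11 (w : List (Fin 2)) (hne : w ≠ [])
    (hw : FibKimberling.IsFactor FibKimberling.fibWord w)
    (hov : ¬ FibKimberling.HasOverlap FibKimberling.fibWord w) :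
    {m : ℕ | FibKimberling.IsPosition (FibKimberling.transform w) 2 m}.Infinite ∧
    ∀ l₀ l₁ l₂ : ℤ,
      l₀ = (FibKimberling.returnWord FibKimberling.fibWord w 0).length →
      l₁ = (FibKimberling.returnWord FibKimberling.fibWord w 1).length - w.length + 1 →
      l₂ = (FibKimberling.returnWord FibKimberling.fibWord w 2).length - w.length + 1 →
      ∀ n : ℕ, 1 ≤ n →
        (FibKimberling.positionSeq (FibKimberling.transform w) 2 n : ℤ) =
          FibKimberling.generalizedBeatty Real.goldenRatio
            (l₁ - l₂) (2 * l₂ - l₁) (l₀ - l₂ + 1) n := by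
  obtain ⟨i, hi⟩ := hw
  obtain ⟨a, b, c, -, -, -, hb, hf, -⟩ := exists_occurrences_affine i w.length
  have hocc : ∀ p, OccursAt fibWord w p ↔ ∃ t, a * zeroCount t + b * t + c = p := fun p => by
    rw [← hf, ← occursAt_slice_iff, show slice fibWord i w.length = w from hi]
  -- Strictness comes from b ≥ 1, as Z is only weakly increasing.
  have hmono : StrictMono fun t => a * zeroCount t + b * t + c := by
    refine strictMono_nat_of_lt_succ fun t => ?_
    have := Nat.mul_le_mul_left a (zeroCount_mono t.le_succ)
    simp only [mul_add, Nat.succ_eq_add_one] at this ⊢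
    omega
  have hinf : (Set.ofPred (OccursAt fibWord w)).Infinite := by
    have e : Set.ofPred (OccursAt fibWord w) = Set.range fun t => a * zeroCount t + b * t + c :=
      Set.ext hocc
    rw [e]
    exact Set.infinite_range_of_injective hmono.injective
  have hnth : ∀ t, occurrence fibWord w t = a * zeroCount t + b * t + c :=
    nth_eq_of_strictMono hmono hocc
  obtain ⟨hpinf, hpos⟩ := transform_positions hne hov hinf
  refine ⟨hpinf, ?_⟩
  rintro l₀ l₁ l₂ rfl rfl rfl n hn
  obtain ⟨t, rfl⟩ := Nat.exists_eq_add_of_le' hn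
  have hz1 : zeroCount 1 = 1 := zeroCount_blockStart_succ 0
  have hz2 : zeroCount 2 = 1 := by
    have := zeroCount_blockStart 1
    rwa [blockStart, hz1] at this
  have hlen := List.length_pos_of_ne_nil hne
  have h := hpos t
  have e0 : (returnWord fibWord w 0).length = c := by
    rw [returnWord, length_slice, hnth]; simp
  have e1 : (returnWord fibWord w 1).length = a + b := by
    rw [returnWord, length_slice, hnth, hnth, zero_add, hz1, zeroCount_zero]; omega
  have e2 : (returnWord fibWord w 2).length = b := by
    rw [returnWord, length_slice, hnth, hnth, one_add_one_eq_two, hz1, hz2]; omega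
  rw [hnth] at h
  -- With n = t + 1 the coefficients are p = a, q = b - a - |w| + 1 and r = c - b + |w|, and both
  -- sides equal a Z(t) + b t + c + 1 - (|w| - 1) t.
  rw [generalizedBeatty, floor_mul_goldenRatio, e0, e1, e2]
  zify [Nat.succ_le_of_lt hlen] at h
  push_cast
  linear_combination h
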